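/- Let $\prec$ be the lexicographic order on $\mathbb C$: $s\prec s'$ iff $\operatorname{Re}s<\operatorname{Re}s'$, or $\operatorname{Re}s=\operatorname{Re}s'$ and $\operatorname{Im}s<\operatorname{Im}s'$. Let $$\varphi=\sum_{k=0}^\infty c_kx^{s_k},\qquad c_k\in\mathbb C,\quad s_0\prec s_1\prec\dots\ \text{in }\mathbb C,\quad \lim_{k\to\infty}\operatorname{Re}s_k=+\infty,$$ be a generalized formal power series. Put $\delta=x\,\frac{d}{dx}$, so that $\delta^j\varphi=\sum_k c_ks_k^jx^{s_k}$. For a formal series $\chi$ in complex powers of $x$ with exponents well ordered by $\prec$, let $\operatorname{ord}\chi$ be the $\prec$-smallest exponent with nonzero coefficient, and $\operatorname{ord}0=+\infty$. Let $F(x,y_0,y_1,\dots,y_n)$ be a polynomial in $n+2$ variables with complex coefficients such that $\varphi$ formally satisfies the equation $F(x,y,\delta y,\dots,\delta^ny)=0$, that is, $F(x,\varphi,\delta\varphi,\dots,\delta^n\varphi)=0$ as a formal series. Assume that $$\frac{\partial F}{\partial y_n}(x,\varphi,\delta\varphi,\dots,\delta^n\varphi)\neq0$$ and that, for all $j=0,1,\dots,n$,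 $$\operatorname{ord}\frac{\partial F}{\partial y_j}(x,\varphi,\delta\varphi,\dots,\delta^n\varphi)\succeq\operatorname{ord}\frac{\partial F}{\partial y_n}(x,\varphi,\delta\varphi,\dots,\delta^n\varphi).$$ Then for every open sector $\{\rho e^{i\theta}:\rho>0,\ \alpha<\theta<\beta\}$ with vertex at the origin and opening $0<\beta-\alpha<2\pi$, and every continuous branch $\ell$ of the logarithm on it (which makes the powers $x^{s_k}=e^{s_k\ell(x)}$ single-valued), there is $r_0>0$ such that for all $0<r\le r_0$ the series $\sum_{k=0}^\infty c_kx^{s_k}$ converges uniformly on the part $\{0<|x|<r\}$ of the sector. -/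

import Mathlib

/-- Complex exponents, ordered by first difference: the complex number `a + b * I` is represented by
the pair `(a, b)`, and pairs are compared lexicographically. -/
abbrev LexExp : Type := ℝ ×ₗ ℝ

namespace LexExp

/-- The exponent corresponding to a complex number. -/
def ofComplex (z : ℂ) : LexExp := toLex (z.re, z.im)

/-- The complex number corresponding to an exponent. -/
def toComplex (g : LexExp) : ℂ := ⟨(ofLex g).1, (ofLex g).2⟩

end LexExp

/-- The ring of formal series in powers `x ^ g`, `g` a complex exponent, with complex coefficients
and well-ordered support. Sums and products are the usual ones (each coefficient of a product is a
finite sum). -/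
abbrev FormalSeries : Type := HahnSeries LexExp ℂ

namespace FormalSeries

/-- The formal monomial `x`. -/
noncomputable def X : FormalSeries := HahnSeries.single (LexExp.ofComplex 1) 1

/-- The formal operator `δ = x d/dx`, which sends `∑ c_g x ^ g` to `∑ c_g g x ^ g`. -/
noncomputable def delta (φ : FormalSeries) : FormalSeries where
  coeff g := g.toComplex * φ.coeff g
  isPWO_support' := φ.isPWO_support'.mono
    (Function.support_subset_iff'.2 fun g hg => by
      rw [Function.notMem_support.1 hg, mul_zero])

/-- The formal series `∑ k, c k * x ^ s k`, for exponents `s 0 ≺ s 1 ≺ …`. -/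
noncomputable def ofSeq (c s : ℕ → ℂ) (hs : StrictMono fun k => LexExp.ofComplex (s k)) :
    FormalSeries :=
  HahnSeries.embDomain (OrderEmbedding.ofStrictMono _ hs)
    (HahnSeries.toPowerSeries.symm (PowerSeries.mk c))

/-- The formal series `G(x, φ, δφ, …, δ^n φ)`, for a polynomial `G(x, y_0, …, y_n)`. The variable
`none` stands for `x` and the variable `some j` for `y_j`. -/
noncomputable def subst {n : ℕ} (G : MvPolynomial (Option (Fin (n + 1))) ℂ) (φ : FormalSeries) :
    FormalSeries :=
  MvPolynomial.aeval (fun v : Option (Fin (n + 1)) => v.elim X fun j => delta^[(j : ℕ)] φ) G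

end FormalSeries

/-- The open infinite sector with vertex at the origin `{ρ e ^ (iθ) | ρ > 0, α < θ < β}`. -/
def openSector (α β : ℝ) : Set ℂ :=
  {x | ∃ ρ θ : ℝ, 0 < ρ ∧ α < θ ∧ θ < β ∧ x = ρ * Complex.exp (θ * Complex.I)}

/-- `ℓ` is a (single-valued, continuous) branch of the logarithm on `S`. -/
def IsLogBranchOn (ℓ : ℂ → ℂ) (S : Set ℂ) : Prop :=
  ContinuousOn ℓ S ∧ ∀ x ∈ S, Complex.exp (ℓ x) = x

/-! At a point with log x = t + ih the power x^g has modulus exp(t Re g − h Im g), and summing the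
moduli of the terms of a series gives a submultiplicative norm, `wnorm t h`. It suffices to make it
finite for φ at two points T ± iH, where H bounds |Im ℓ| on the sector. Indeed, if Re ℓ ≤ T and Re
s_k ≥ 0, then |x^{s_k}| is at most its value at one of these points, chosen by the sign of Im s_k,
and the Weierstrass M-test applies.

Fix one of the lines Im log x = ±H, and let Λ be the real part of the order of ∂F/∂y_n. By the order
hypothesis every ∂F/∂y_j has its exponents in Re ≥ Λ; let A_j be its part on Re = Λ, a finite sum.
Several exponents may share that line, but for H large one term of A_n outweighs the others
(`exists_dominant_term`).

Cut φ = P + ψ at real part M. Taylor expansion (`MvPolynomial.exists_taylor_two`) turns the equation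
into Σ A_j δ^j ψ = −F(P) − Σ B_j δ^j ψ − Q(ψ), where the B_j have exponents in Re ≥ Λ + ε and Q is
quadratic. On the tail δ multiplies coefficients by numbers of modulus at least M, so the terms with
j < n are absorbed and the dominant monomial of A_n can be inverted
(`wnorm_iterate_delta_trunc_le`). Up to real part R + Λ the right side sees ψ only up to R − ε. For
t near −∞ a bound on δ^n ψ therefore propagates by steps of ε to all truncations
(`exists_wnorm_ne_top`). -/

/-- The real exponential, with values in the extended nonnegative reals. -/
noncomputable def eexp (x : ℝ) : ENNReal := ENNReal.ofReal (Real.exp x)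

lemma eexp_add (x y : ℝ) : eexp (x + y) = eexp x * eexp y := by
  rw [eexp, Real.exp_add, ENNReal.ofReal_mul (Real.exp_pos x).le]; rfl

lemma eexp_zero : eexp 0 = 1 := by simp [eexp]

lemma eexp_mono {x y : ℝ} (h : x ≤ y) : eexp x ≤ eexp y :=
  ENNReal.ofReal_le_ofReal (Real.exp_le_exp.2 h)

lemma eexp_ne_top (x : ℝ) : eexp x ≠ ⊤ := ENNReal.ofReal_ne_top

lemma tendsto_eexp_mul {ε : ℝ} (hε : 0 < ε) :
    Filter.Tendsto (fun t => eexp (t * ε)) Filter.atBot (nhds 0) := by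
  have h := ENNReal.tendsto_ofReal (Real.tendsto_exp_atBot.comp
    (Filter.tendsto_id.atBot_mul_const hε))
  simpa [eexp] using h

/-! ### Exponents and the moduli of their powers -/

namespace LexExp

lemma re_add (a b : LexExp) : (a + b).toComplex.re = a.toComplex.re + b.toComplex.re := rfl

lemma im_add (a b : LexExp) : (a + b).toComplex.im = a.toComplex.im + b.toComplex.im := rfl

lemma re_neg (a : LexExp) : (-a).toComplex.re = -a.toComplex.re := rfl

lemma im_neg (a : LexExp) : (-a).toComplex.im = -a.toComplex.im := rfl

lemma re_le_re {a b : LexExp} (h : a ≤ b) : a.toComplex.re ≤ b.toComplex.re := by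
  rcases Prod.Lex.le_iff.1 h with h | h
  · exact h.le
  · exact h.1.le

lemma ext_re_im {a b : LexExp} (h₁ : a.toComplex.re = b.toComplex.re)
    (h₂ : a.toComplex.im = b.toComplex.im) : a = b := by
  exact ofLex.injective (Prod.ext h₁ h₂)

/-- The modulus of `x ^ g` at a point where `log x = t + h * I`. -/
noncomputable def weight (t h : ℝ) (g : LexExp) : ENNReal :=
  eexp (t * g.toComplex.re - h * g.toComplex.im)

lemma weight_add (t h : ℝ) (a b : LexExp) : weight t h (a + b) = weight t h a * weight t h b := by
  rw [weight, weight, weight, ← eexp_add, re_add, im_add]; ring_nf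

lemma weight_zero (t h : ℝ) : weight t h 0 = 1 := by
  have h0 : (0 : LexExp).toComplex = 0 := rfl
  simp [weight, h0, eexp_zero]

lemma weight_ne_top (t h : ℝ) (g : LexExp) : weight t h g ≠ ⊤ := eexp_ne_top _

lemma weight_eq_mul (t h : ℝ) (g : LexExp) :
    weight t h g = eexp (t * g.toComplex.re) * weight 0 h g := by
  rw [weight, weight, ← eexp_add]; ring_nf

end LexExp

namespace FormalSeries

/-! ### Weighted norms -/

/-- The weighted `ℓ¹` norm of a formal series, at a point where `log x = t + h * I`. -/
noncomputable def wnorm (t h : ℝ) (f : FormalSeries) : ENNReal :=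
  ∑' g, ‖f.coeff g‖ₑ * LexExp.weight t h g

variable {t h : ℝ} {f f' : FormalSeries}

lemma wnorm_mono (H : ∀ g, ‖f.coeff g‖ₑ ≤ ‖f'.coeff g‖ₑ) : wnorm t h f ≤ wnorm t h f' :=
  ENNReal.tsum_le_tsum fun g => mul_le_mul_left (H g) _

lemma wnorm_zero : wnorm t h 0 = 0 := by simp [wnorm]

lemma wnorm_neg : wnorm t h (-f) = wnorm t h f := by simp [wnorm]

lemma wnorm_add_le : wnorm t h (f + f') ≤ wnorm t h f + wnorm t h f' := by
  rw [wnorm, wnorm, wnorm, ← ENNReal.tsum_add]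
  refine ENNReal.tsum_le_tsum fun g => ?_
  rw [← add_mul, HahnSeries.coeff_add]
  exact mul_le_mul_left (enorm_add_le _ _) _

lemma wnorm_sub_le : wnorm t h (f - f') ≤ wnorm t h f + wnorm t h f' := by
  rw [sub_eq_add_neg, ← wnorm_neg (f := f')]
  exact wnorm_add_le

lemma wnorm_sum_le {ι : Type*} (s : Finset ι) (F : ι → FormalSeries) :
    wnorm t h (∑ i ∈ s, F i) ≤ ∑ i ∈ s, wnorm t h (F i) := by
  classical
  induction s using Finset.induction_on with
  | empty => simp [wnorm_zero]
  | insert a s ha ih =>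
    rw [Finset.sum_insert ha, Finset.sum_insert ha]
    exact wnorm_add_le.trans (by gcongr)

lemma wnorm_single (g : LexExp) (a : ℂ) :
    wnorm t h (HahnSeries.single g a) = ‖a‖ₑ * LexExp.weight t h g := by
  rw [wnorm, tsum_eq_single g]
  · simp
  · intro b hb
    simp [HahnSeries.coeff_single_of_ne hb]

/-- The weight is multiplicative in the exponent, so the product of the two sums is a double sum
that can be regrouped along `p.1 + p.2 = g`. -/
lemma wnorm_mul_le : wnorm t h (f * f') ≤ wnorm t h f * wnorm t h f' := by
  classical
  let T : LexExp → LexExp → ENNReal := fun a b =>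
    (‖f.coeff a‖ₑ * LexExp.weight t h a) * (‖f'.coeff b‖ₑ * LexExp.weight t h b)
  have key : ∀ g, ‖(f * f').coeff g‖ₑ * LexExp.weight t h g ≤
      ∑' p : LexExp × LexExp, if p.1 + p.2 = g then T p.1 p.2 else 0 := by
    intro g
    rw [HahnSeries.coeff_mul]
    refine (mul_le_mul_left (enorm_sum_le _ _) _).trans ?_
    rw [Finset.sum_mul]
    refine le_trans (Finset.sum_le_sum fun p hp => ?_) (ENNReal.sum_le_tsum _)
    have hpg := (Finset.mem_antidiagonal.1 hp).2.2
    rw [if_pos hpg, ← hpg, LexExp.weight_add, enorm_mul]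
    exact le_of_eq (by ring)
  calc wnorm t h (f * f')
      ≤ ∑' g, ∑' p : LexExp × LexExp, if p.1 + p.2 = g then T p.1 p.2 else 0 :=
        ENNReal.tsum_le_tsum key
    _ = ∑' p : LexExp × LexExp, T p.1 p.2 := by
        rw [ENNReal.tsum_comm]
        refine tsum_congr fun p => ?_
        rw [tsum_eq_single (p.1 + p.2)]
        · simp
        · intro b hb
          rw [if_neg hb.symm]
    _ = wnorm t h f * wnorm t h f' := by
        rw [ENNReal.tsum_prod, wnorm, wnorm, ← ENNReal.tsum_mul_right]
        exact tsum_congr fun a => ENNReal.tsum_mul_left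

/-- A monomial is invertible, and its inverse is again a monomial of known norm. -/
lemma wnorm_le_single_mul {g : LexExp} {a : ℂ} (ha : a ≠ 0) :
    wnorm t h f ≤ ‖a⁻¹‖ₑ * LexExp.weight t h (-g) * wnorm t h (HahnSeries.single g a * f) := by
  have H : f = HahnSeries.single (-g) a⁻¹ * (HahnSeries.single g a * f) := by
    rw [← mul_assoc, HahnSeries.single_mul_single, neg_add_cancel, inv_mul_cancel₀ ha]
    exact (one_mul f).symm
  conv_lhs => rw [H]
  rw [← wnorm_single]
  exact wnorm_mul_le

lemma wnorm_ne_top_of_finite (hf : f.support.Finite) : wnorm t h f ≠ ⊤ := by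
  rw [wnorm, tsum_eq_sum (s := hf.toFinset)]
  · exact ENNReal.sum_ne_top.2 fun _ _ => ENNReal.mul_ne_top enorm_ne_top (LexExp.weight_ne_top _ _ _)
  · intro g hg
    have : f.coeff g = 0 := by simpa using hg
    simp [this]

/-! ### Real parts of exponents -/

/-- All exponents of `f` have their real part in `I`. -/
def ReMem (I : Set ℝ) (f : FormalSeries) : Prop := ∀ g, f.coeff g ≠ 0 → g.toComplex.re ∈ I

variable {I J K : Set ℝ}

lemma ReMem.mono (hf : ReMem I f) (H : I ⊆ J) : ReMem J f := fun g hg => H (hf g hg)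

lemma ReMem.zero : ReMem I 0 := fun _ hg => absurd rfl hg

lemma ReMem.add (hf : ReMem I f) (hf' : ReMem I f') : ReMem I (f + f') := by
  intro g hg
  by_cases h0 : f.coeff g = 0
  · exact hf' g fun h1 => hg (by rw [HahnSeries.coeff_add, h0, h1, add_zero])
  · exact hf g h0

lemma ReMem.neg (hf : ReMem I f) : ReMem I (-f) := fun g hg =>
  hf g fun h0 => hg (by rw [HahnSeries.coeff_neg, h0, neg_zero])

lemma ReMem.sub (hf : ReMem I f) (hf' : ReMem I f') : ReMem I (f - f') := by
  rw [sub_eq_add_neg]; exact hf.add hf'.neg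

lemma ReMem.sum {ι : Type*} {s : Finset ι} {F : ι → FormalSeries}
    (H : ∀ i ∈ s, ReMem I (F i)) : ReMem I (∑ i ∈ s, F i) :=
  Finset.sum_induction _ _ (fun _ _ => ReMem.add) ReMem.zero H

lemma ReMem.mul (hf : ReMem I f) (hf' : ReMem J f') (H : ∀ a ∈ I, ∀ b ∈ J, a + b ∈ K) :
    ReMem K (f * f') := by
  intro g hg
  obtain ⟨a, ha, b, hb, rfl⟩ := HahnSeries.support_mul_subset ((HahnSeries.mem_support _ _).2 hg)
  exact H _ (hf a ha) _ (hf' b hb)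

lemma ReMem.single {g : LexExp} {a : ℂ} (hg : g.toComplex.re ∈ I) :
    ReMem I (HahnSeries.single g a) := by
  intro b hb
  by_cases hbg : b = g
  · rwa [hbg]
  · exact absurd (HahnSeries.coeff_single_of_ne hbg) hb

lemma ReMem.algebraMap (a : ℂ) (h0 : (0 : ℝ) ∈ I) :
    ReMem I (algebraMap ℂ FormalSeries a) := by
  rw [HahnSeries.algebraMap_apply]
  exact ReMem.single h0

/-- The source of all decay as `t → -∞`: each term carries a factor `eexp (t * Re g)`. -/
lemma wnorm_le_of_reMem_Ici {b : ℝ} (ht : t ≤ 0) (hf : ReMem (Set.Ici b) f) :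
    wnorm t h f ≤ eexp (t * b) * wnorm 0 h f := by
  rw [wnorm, wnorm, ← ENNReal.tsum_mul_left]
  refine ENNReal.tsum_le_tsum fun g => ?_
  by_cases h0 : f.coeff g = 0
  · simp [h0]
  · rw [LexExp.weight_eq_mul t, mul_left_comm]
    gcongr
    exact eexp_mono (mul_le_mul_of_nonpos_left (hf g h0) ht)

lemma exists_reMem_Ici_of_finite {b : ℝ} (hf : f.support.Finite) (hb : ReMem (Set.Ioi b) f) :
    ∃ ε : ℝ, 0 < ε ∧ ReMem (Set.Ici (b + ε)) f := by
  have : ∀ᶠ ε in nhdsWithin (0 : ℝ) (Set.Ioi 0), ∀ g ∈ f.support, b + ε ≤ g.toComplex.re := by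
    rw [Filter.eventually_all_finite hf]
    intro g hg
    have h1 : 0 < g.toComplex.re - b := sub_pos.2 (hb g hg)
    filter_upwards [Ioo_mem_nhdsGT h1] with ε hε
    linarith [hε.2]
  obtain ⟨ε, h1, h2⟩ := (this.and self_mem_nhdsWithin).exists
  exact ⟨ε, h2, h1⟩

/-! ### Truncation -/

open Classical in
/-- The part of `f` whose exponents have real part at most `R`. -/
noncomputable def trunc (R : ℝ) (f : FormalSeries) : FormalSeries where
  coeff g := if g.toComplex.re ≤ R then f.coeff g else 0
  isPWO_support' := f.isPWO_support'.mono (Function.support_subset_iff'.2 fun g hg => by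
    rw [Function.notMem_support.1 hg, ite_self])

lemma coeff_trunc_of_le {R : ℝ} {g : LexExp} (hg : g.toComplex.re ≤ R) :
    (trunc R f).coeff g = f.coeff g := if_pos hg

lemma coeff_trunc_of_lt {R : ℝ} {g : LexExp} (hg : R < g.toComplex.re) :
    (trunc R f).coeff g = 0 := if_neg hg.not_ge

variable {R : ℝ}

lemma coeff_trunc_eq_or (g : LexExp) :
    (trunc R f).coeff g = f.coeff g ∨ (trunc R f).coeff g = 0 :=
  (le_or_gt g.toComplex.re R).imp coeff_trunc_of_le coeff_trunc_of_lt

lemma trunc_add : trunc R (f + f') = trunc R f + trunc R f' := by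
  ext g
  rcases le_or_gt g.toComplex.re R with hg | hg
  · simp [coeff_trunc_of_le hg]
  · simp [coeff_trunc_of_lt hg]

lemma trunc_sub : trunc R (f - f') = trunc R f - trunc R f' := by
  ext g
  rcases le_or_gt g.toComplex.re R with hg | hg
  · simp [coeff_trunc_of_le hg]
  · simp [coeff_trunc_of_lt hg]

lemma trunc_sum {ι : Type*} (s : Finset ι) (F : ι → FormalSeries) :
    trunc R (∑ i ∈ s, F i) = ∑ i ∈ s, trunc R (F i) := by
  classical
  induction s using Finset.induction_on with
  | empty =>
    ext g
    rcases coeff_trunc_eq_or (f := 0) (R := R) g with h0 | h0 <;> simpa using h0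
  | insert a s ha ih => rw [Finset.sum_insert ha, Finset.sum_insert ha, trunc_add, ih]

lemma wnorm_trunc_le : wnorm t h (trunc R f) ≤ wnorm t h f :=
  wnorm_mono fun g => by rcases coeff_trunc_eq_or (f := f) (R := R) g with hg | hg <;> simp [hg]

lemma ReMem.trunc (hf : ReMem I f) : ReMem I (trunc R f) := by
  intro g hg
  rcases coeff_trunc_eq_or (f := f) (R := R) g with h0 | h0
  · exact hf g (h0 ▸ hg)
  · exact absurd h0 hg

lemma reMem_Iic_trunc : ReMem (Set.Iic R) (FormalSeries.trunc R f) := by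
  intro g hg
  by_contra h0
  exact hg (coeff_trunc_of_lt (not_le.1 h0))

lemma reMem_Ioi_sub_trunc : ReMem (Set.Ioi R) (f - FormalSeries.trunc R f) := by
  intro g hg
  by_contra h0
  exact hg (by rw [HahnSeries.coeff_sub, coeff_trunc_of_le (not_lt.1 h0), sub_self])

lemma trunc_eq_zero (hf : ReMem (Set.Ioi R) f) : trunc R f = 0 := by
  ext g
  by_contra h0
  have h1 : (FormalSeries.trunc R f).coeff g ≠ 0 := h0
  exact not_lt_of_ge (Set.mem_Iic.1 (reMem_Iic_trunc g h1)) (hf.trunc g h1)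

lemma trunc_eq_self (hf : ReMem (Set.Iic R) f) : trunc R f = f := by
  ext g
  by_cases h0 : f.coeff g = 0
  · rcases coeff_trunc_eq_or (f := f) (R := R) g with hg | hg <;> simp [hg, h0]
  · exact coeff_trunc_of_le (hf g h0)

lemma trunc_congr (H : ReMem (Set.Ioi R) (f - f')) : trunc R f = trunc R f' := by
  rw [← sub_eq_zero, ← trunc_sub, trunc_eq_zero H]

/-- Multiplication by a series on one vertical line shifts every real part by exactly `b`, so it
carries one truncation level to another. -/
lemma trunc_mul_of_reMem_singleton {b : ℝ} (hf : ReMem {b} f) :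
    trunc (R + b) (f * f') = f * trunc R f' := by
  rw [← trunc_eq_self (R := R + b) (f := f * trunc R f')]
  · refine trunc_congr ?_
    rw [← mul_sub]
    refine hf.mul reMem_Ioi_sub_trunc ?_
    rintro _ rfl c hc
    simp only [Set.mem_Ioi] at *
    linarith
  · refine hf.mul reMem_Iic_trunc ?_
    rintro _ rfl c hc
    simp only [Set.mem_Iic] at *
    linarith

/-! ### The operator `δ` -/

lemma coeff_iterate_delta (j : ℕ) (g : LexExp) :
    (delta^[j] f).coeff g = g.toComplex ^ j * f.coeff g := by
  induction j with
  | zero => simp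
  | succ j ih =>
    rw [Function.iterate_succ_apply', pow_succ', mul_assoc, ← ih]
    rfl

lemma iterate_delta_add (j : ℕ) : delta^[j] (f + f') = delta^[j] f + delta^[j] f' := by
  ext g; simp [coeff_iterate_delta, mul_add]

lemma iterate_delta_trunc (j : ℕ) : delta^[j] (trunc R f) = trunc R (delta^[j] f) := by
  ext g
  rcases le_or_gt g.toComplex.re R with hg | hg <;>
    simp [coeff_iterate_delta, coeff_trunc_of_le, coeff_trunc_of_lt, hg]

lemma ReMem.iterate_delta (hf : ReMem I f) (j : ℕ) : ReMem I (delta^[j] f) := by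
  intro g hg
  rw [coeff_iterate_delta] at hg
  exact hf g (right_ne_zero_of_mul hg)

lemma iterate_delta_support_subset (j : ℕ) : (delta^[j] f).support ⊆ f.support := by
  intro g hg
  rw [HahnSeries.mem_support, coeff_iterate_delta] at hg
  exact right_ne_zero_of_mul hg

lemma wnorm_iterate_delta_le {b : ℝ} (hb : 1 ≤ b) (hf : ReMem (Set.Ici b) f) {i j : ℕ}
    (hij : i ≤ j) : wnorm t h (delta^[i] f) ≤ wnorm t h (delta^[j] f) := by
  refine wnorm_mono fun g => ?_
  by_cases h0 : f.coeff g = 0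
  · simp [coeff_iterate_delta, h0]
  · have h1 : 1 ≤ ‖g.toComplex‖ := (hb.trans (hf g h0)).trans (Complex.re_le_norm _)
    rw [coeff_iterate_delta, coeff_iterate_delta, enorm_mul, enorm_mul]
    gcongr
    rw [← ofReal_norm, ← ofReal_norm, norm_pow, norm_pow]
    exact ENNReal.ofReal_le_ofReal (pow_le_pow_right₀ h1 hij)

/-- Each `δ` multiplies the coefficient at `g` by `g`, and `‖g‖ ≥ Re g ≥ b`. This makes lower-order
derivatives of a far tail small relative to the top one. -/
lemma mul_wnorm_iterate_delta_le {b : ℝ} (hb : 1 ≤ b) (hf : ReMem (Set.Ici b) f) {i j : ℕ}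
    (hij : i < j) :
    ENNReal.ofReal b * wnorm t h (delta^[i] f) ≤ wnorm t h (delta^[j] f) := by
  refine le_trans ?_ (wnorm_iterate_delta_le hb hf (Nat.succ_le_of_lt hij))
  rw [wnorm, wnorm, ← ENNReal.tsum_mul_left]
  refine ENNReal.tsum_le_tsum fun g => ?_
  by_cases h0 : f.coeff g = 0
  · simp [coeff_iterate_delta, h0]
  · have h1 : b ≤ ‖g.toComplex‖ := le_trans (hf g h0) (Complex.re_le_norm _)
    have e : ‖g.toComplex ^ i.succ * f.coeff g‖ₑ = ‖g.toComplex‖ₑ * ‖g.toComplex ^ i * f.coeff g‖ₑ := by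
      rw [pow_succ', mul_assoc, enorm_mul]
    rw [coeff_iterate_delta, coeff_iterate_delta, e, mul_assoc]
    gcongr
    rw [← ofReal_norm (x := g.toComplex)]
    exact ENNReal.ofReal_le_ofReal h1

/-! ### Polynomials in formal series -/

variable {σ : Type*}

lemma finite_support_add (hf : f.support.Finite) (hf' : f'.support.Finite) :
    (f + f').support.Finite :=
  (hf.union hf').subset (HahnSeries.support_add_subset _ _)

lemma finite_support_mul (hf : f.support.Finite) (hf' : f'.support.Finite) :
    (f * f').support.Finite :=
  (hf.add hf').subset HahnSeries.support_mul_subset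

lemma finite_support_aeval (G : MvPolynomial σ ℂ) {p : σ → FormalSeries}
    (hp : ∀ v, (p v).support.Finite) : (MvPolynomial.aeval p G).support.Finite := by
  induction G using MvPolynomial.induction_on with
  | C a =>
    rw [MvPolynomial.aeval_C, HahnSeries.algebraMap_apply]
    exact (Set.finite_singleton _).subset HahnSeries.support_single_subset
  | add G G' hG hG' => rw [map_add]; exact finite_support_add hG hG'
  | mul_X G v hG => rw [map_mul, MvPolynomial.aeval_X]; exact finite_support_mul hG (hp v)

/-- The loss `ν` depends only on `G` and `b`. Allowing every `ν ≥ ν₁` lets finitely many polynomials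
share one value. -/
lemma exists_reMem_Ici_aeval (G : MvPolynomial σ ℂ) (b : ℝ) :
    ∃ ν₁ : ℝ, ∀ ν ≥ ν₁, ∀ p : σ → FormalSeries, (∀ v, ReMem (Set.Ici (-b)) (p v)) →
      ReMem (Set.Ici (-ν)) (MvPolynomial.aeval p G) := by
  induction G using MvPolynomial.induction_on with
  | C a =>
    refine ⟨0, fun ν hν p hp => ?_⟩
    rw [MvPolynomial.aeval_C]
    exact ReMem.algebraMap a (by simpa using hν)
  | add G G' hG hG' =>
    obtain ⟨ν₁, h₁⟩ := hG
    obtain ⟨ν₂, h₂⟩ := hG'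
    refine ⟨max ν₁ ν₂, fun ν hν p hp => ?_⟩
    rw [map_add]
    exact (h₁ ν (le_of_max_le_left hν) p hp).add (h₂ ν (le_of_max_le_right hν) p hp)
  | mul_X G v hG =>
    obtain ⟨ν₁, h₁⟩ := hG
    refine ⟨ν₁ + b, fun ν hν p hp => ?_⟩
    rw [map_mul, MvPolynomial.aeval_X]
    refine (h₁ (ν - b) (by linarith) p hp).mul (hp v) ?_
    intro x hx y hy
    simp only [Set.mem_Ici] at *
    linarith

lemma exists_reMem_Ioi_aeval_sub (G : MvPolynomial σ ℂ) (b : ℝ) :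
    ∃ ν₁ : ℝ, ∀ ν ≥ ν₁, ∀ (R : ℝ) (p p' : σ → FormalSeries), (∀ v, ReMem (Set.Ici (-b)) (p v)) →
      (∀ v, ReMem (Set.Ici (-b)) (p' v)) → (∀ v, ReMem (Set.Ioi R) (p v - p' v)) →
      ReMem (Set.Ioi (R - ν)) (MvPolynomial.aeval p G - MvPolynomial.aeval p' G) := by
  induction G using MvPolynomial.induction_on with
  | C a =>
    refine ⟨0, fun ν hν R p p' _ _ _ => ?_⟩
    rw [MvPolynomial.aeval_C, MvPolynomial.aeval_C, sub_self]
    exact ReMem.zero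
  | add G G' hG hG' =>
    obtain ⟨ν₁, h₁⟩ := hG
    obtain ⟨ν₂, h₂⟩ := hG'
    refine ⟨max ν₁ ν₂, fun ν hν R p p' hp hp' H => ?_⟩
    rw [map_add, map_add, add_sub_add_comm]
    exact (h₁ ν (le_of_max_le_left hν) R p p' hp hp' H).add
      (h₂ ν (le_of_max_le_right hν) R p p' hp hp' H)
  | mul_X G v hG =>
    obtain ⟨ν₁, h₁⟩ := hG
    obtain ⟨ν₂, h₂⟩ := exists_reMem_Ici_aeval G b
    refine ⟨max (ν₁ + b) ν₂, fun ν hν R p p' hp hp' H => ?_⟩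
    have e : MvPolynomial.aeval p (G * MvPolynomial.X v) -
        MvPolynomial.aeval p' (G * MvPolynomial.X v) =
        MvPolynomial.aeval p G * (p v - p' v) +
          (MvPolynomial.aeval p G - MvPolynomial.aeval p' G) * p' v := by
      simp only [map_mul, MvPolynomial.aeval_X]; ring
    rw [e]
    refine ReMem.add ?_ ?_
    · refine (h₂ ν (le_of_max_le_right hν) p hp).mul (H v) ?_
      intro x hx y hy
      simp only [Set.mem_Ici, Set.mem_Ioi] at *
      linarith
    · refine (h₁ (ν - b) (by linarith [le_of_max_le_left hν]) R p p' hp hp' H).mul (hp' v) ?_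
      intro x hx y hy
      simp only [Set.mem_Ici, Set.mem_Ioi] at *
      linarith

/-- The constant `C` is chosen before `t` and `p`: uniformity in `t` is what later allows `t → -∞`.
-/
lemma exists_wnorm_aeval_le (h : ℝ) (G : MvPolynomial σ ℂ) (b : ℝ) :
    ∃ ν₁ : ℝ, ∀ ν ≥ ν₁, ∀ K : ENNReal, K ≠ ⊤ → ∃ C : ENNReal, C ≠ ⊤ ∧ ∀ t ≤ 0,
      ∀ p : σ → FormalSeries, (∀ v, wnorm t h (p v) ≤ K * eexp (t * -b)) →
      wnorm t h (MvPolynomial.aeval p G) ≤ C * eexp (t * -ν) := by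
  induction G using MvPolynomial.induction_on with
  | C a =>
    refine ⟨0, fun ν hν K _ => ⟨‖a‖ₑ, enorm_ne_top, fun t ht p _ => ?_⟩⟩
    have e : MvPolynomial.aeval p (MvPolynomial.C a : MvPolynomial σ ℂ) =
        HahnSeries.single (0 : LexExp) a := by
      rw [MvPolynomial.aeval_C, HahnSeries.algebraMap_apply]; rfl
    rw [e, wnorm_single, LexExp.weight_zero, ← eexp_zero]
    gcongr
    exact eexp_mono (by nlinarith)
  | add G G' hG hG' =>
    obtain ⟨ν₁, h₁⟩ := hG
    obtain ⟨ν₂, h₂⟩ := hG'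
    refine ⟨max ν₁ ν₂, fun ν hν K hK => ?_⟩
    obtain ⟨C₁, hC₁, H₁⟩ := h₁ ν (le_of_max_le_left hν) K hK
    obtain ⟨C₂, hC₂, H₂⟩ := h₂ ν (le_of_max_le_right hν) K hK
    refine ⟨C₁ + C₂, ENNReal.add_ne_top.2 ⟨hC₁, hC₂⟩, fun t ht p hp => ?_⟩
    rw [map_add, add_mul]
    exact wnorm_add_le.trans (add_le_add (H₁ t ht p hp) (H₂ t ht p hp))
  | mul_X G v hG =>
    obtain ⟨ν₁, h₁⟩ := hG
    refine ⟨ν₁ + b, fun ν hν K hK => ?_⟩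
    obtain ⟨C, hC, H⟩ := h₁ (ν - b) (by linarith) K hK
    refine ⟨C * K, ENNReal.mul_ne_top hC hK, fun t ht p hp => ?_⟩
    rw [map_mul, MvPolynomial.aeval_X]
    refine wnorm_mul_le.trans ((mul_le_mul' (H t ht p hp) (hp v)).trans (le_of_eq ?_))
    rw [mul_mul_mul_comm, ← eexp_add]
    ring_nf

end FormalSeries

/-! ### Taylor expansion and an absorption inequality -/

/-- Second order Taylor expansion of a polynomial, with polynomial remainder. -/
lemma MvPolynomial.exists_taylor_two {σ K : Type*} [Fintype σ] [DecidableEq σ] [CommRing K]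
    (G : MvPolynomial σ K) :
    ∃ H : σ → σ → MvPolynomial (σ ⊕ σ) K, ∀ {A : Type*} [CommRing A] [Algebra K A] (p q : σ → A),
      aeval (fun v => p v + q v) G = aeval p G + ∑ v, aeval p (pderiv v G) * q v +
        ∑ u, ∑ v, aeval (Sum.elim p q) (H u v) * (q u * q v) := by
  induction G using MvPolynomial.induction_on with
  | C a => exact ⟨0, fun p q => by simp⟩
  | add G G' hG hG' =>
    obtain ⟨H, hH⟩ := hG
    obtain ⟨H', hH'⟩ := hG'
    refine ⟨H + H', fun p q => ?_⟩
    simp only [map_add, Pi.add_apply, add_mul, Finset.sum_add_distrib, hH, hH']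
    ring
  | mul_X G w hG =>
    obtain ⟨H, hH⟩ := hG
    -- The extra summand is the product of the linear part of `G` with the increment `q w`, recorded
    -- in the row `u = w`.
    refine ⟨fun u v => (X (Sum.inl w) + X (Sum.inr w)) * H u v +
      if u = w then rename Sum.inl (pderiv v G) else 0, fun p q => ?_⟩
    have e₁ : ∑ v, aeval p (pderiv v (G * X w)) * q v =
        (∑ v, aeval p (pderiv v G) * q v) * p w + aeval p G * q w := by
      simp only [Derivation.leibniz, smul_eq_mul, pderiv_X, map_add, map_mul, aeval_X, add_mul,
        Finset.sum_add_distrib, Finset.sum_mul]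
      rw [add_comm]
      congr 1
      · exact Finset.sum_congr rfl fun v _ => by ring
      · rw [Finset.sum_eq_single w]
        · simp
        · intro v _ hv
          simp [Pi.single_eq_of_ne hv.symm]
        · simp
    have e₂ : ∀ u v, aeval (Sum.elim p q) ((X (Sum.inl w) + X (Sum.inr w)) * H u v +
        if u = w then rename Sum.inl (pderiv v G) else 0) * (q u * q v) =
        (p w + q w) * (aeval (Sum.elim p q) (H u v) * (q u * q v)) +
        if u = w then aeval p (pderiv v G) * q v * q w else 0 := by
      intro u v
      split_ifs with huw
      · subst huw
        simp only [map_add, map_mul, aeval_X, Sum.elim_inl, Sum.elim_inr, aeval_rename,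
          Sum.elim_comp_inl]
        ring
      · simp only [map_add, map_mul, aeval_X, Sum.elim_inl, Sum.elim_inr, map_zero]
        ring
    simp only [e₁, e₂, Finset.sum_add_distrib, ← Finset.mul_sum]
    rw [map_mul, map_mul, aeval_X, aeval_X, hH, Finset.sum_comm (γ := σ)
      (f := fun u v => if u = w then aeval p (pderiv v G) * q v * q w else 0)]
    simp only [Finset.sum_ite_eq', Finset.mem_univ, if_true, ← Finset.sum_mul]
    ring

/-- Absorption needs `x` finite, which is why the estimates are made on truncations and not on the
series itself. -/
lemma ENNReal.le_two_mul_of_le_add_quarters {x y : ENNReal} (hx : x ≠ ⊤)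
    (H : x ≤ y + (4⁻¹ * x + 4⁻¹ * x)) : x ≤ 2 * y := by
  have e4 : (4 : ENNReal)⁻¹ + 4⁻¹ = 2⁻¹ := by
    rw [← two_mul, show (4 : ENNReal) = 2 * 2 by norm_num,
      ENNReal.mul_inv (Or.inl two_ne_zero) (Or.inl ENNReal.ofNat_ne_top), ← mul_assoc,
      ENNReal.mul_inv_cancel two_ne_zero ENNReal.ofNat_ne_top, one_mul]
  have h2 : (2 : ENNReal)⁻¹ * x ≠ ⊤ := ENNReal.mul_ne_top (by simp) hx
  have h3 : 2⁻¹ * x + 2⁻¹ * x ≤ y + 2⁻¹ * x := by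
    rwa [← add_mul, ENNReal.inv_two_add_inv_two, one_mul, ← e4, add_mul]
  have h4 := ENNReal.le_of_add_le_add_right h2 h3
  calc x = 2 * (2⁻¹ * x) := by
        rw [← mul_assoc, ENNReal.mul_inv_cancel two_ne_zero ENNReal.ofNat_ne_top, one_mul]
    _ ≤ 2 * y := by gcongr

/-! ### Dominant term and linear a priori estimate -/

namespace FormalSeries

/-- On a horizontal line `Im log x = h` with `|h|` large, one term of a finite exponential sum
dominates all others. -/
lemma exists_dominant_term {A : FormalSeries} (hA : A.support.Finite) (h0 : A ≠ 0) {Λ : ℝ}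
    (hΛ : ReMem {Λ} A) (σ : ℝ) (hσ : σ ≠ 0) :
    ∃ g₀, A.coeff g₀ ≠ 0 ∧ ∀ᶠ H in Filter.atTop,
      ‖(A.coeff g₀)⁻¹‖ₑ * LexExp.weight 0 (σ * H) (-g₀) *
        wnorm 0 (σ * H) (A - HahnSeries.single g₀ (A.coeff g₀)) ≤ 4⁻¹ := by
  classical
  have hne : hA.toFinset.Nonempty := by
    rw [Set.Finite.toFinset_nonempty]
    exact HahnSeries.support_nonempty_iff.2 h0
  -- At `t = 0`, `h = σ * H` the power with exponent `g` has modulus `exp (-H * (σ * Im g))`, so the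
  -- smallest `σ * Im g` wins as `H → ∞`.
  obtain ⟨g₀, hg₀, hmin⟩ := hA.toFinset.exists_min_image (fun g => σ * g.toComplex.im) hne
  have hg₀' : A.coeff g₀ ≠ 0 := by simpa using hg₀
  refine ⟨g₀, hg₀', ?_⟩
  have hw : ∀ H, wnorm 0 (σ * H) (A - HahnSeries.single g₀ (A.coeff g₀)) =
      ∑ g ∈ hA.toFinset.erase g₀, ‖A.coeff g‖ₑ * LexExp.weight 0 (σ * H) g := by
    intro H
    rw [wnorm, tsum_eq_sum (s := hA.toFinset.erase g₀)]
    · refine Finset.sum_congr rfl fun g hg => ?_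
      rw [HahnSeries.coeff_sub, HahnSeries.coeff_single_of_ne (Finset.ne_of_mem_erase hg), sub_zero]
    · intro g hg
      by_cases hgg : g = g₀
      · simp [hgg]
      · have : A.coeff g = 0 := by
          by_contra hc
          exact hg (Finset.mem_erase.2 ⟨hgg, by simpa using hc⟩)
        simp [HahnSeries.coeff_single_of_ne hgg, this]
  have hlim : Filter.Tendsto (fun H => ‖(A.coeff g₀)⁻¹‖ₑ * LexExp.weight 0 (σ * H) (-g₀) *
        wnorm 0 (σ * H) (A - HahnSeries.single g₀ (A.coeff g₀))) Filter.atTop (nhds 0) := by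
    have e : ∀ H, ‖(A.coeff g₀)⁻¹‖ₑ * LexExp.weight 0 (σ * H) (-g₀) *
        wnorm 0 (σ * H) (A - HahnSeries.single g₀ (A.coeff g₀)) =
        ∑ g ∈ hA.toFinset.erase g₀, ‖(A.coeff g₀)⁻¹‖ₑ * ‖A.coeff g‖ₑ *
          eexp (-H * (σ * g.toComplex.im - σ * g₀.toComplex.im)) := by
      intro H
      rw [hw, Finset.mul_sum]
      refine Finset.sum_congr rfl fun g _ => ?_
      rw [mul_mul_mul_comm, ← LexExp.weight_add, LexExp.weight, LexExp.im_add, LexExp.im_neg]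
      ring_nf
    simp only [e]
    rw [show (0 : ENNReal) = ∑ g ∈ hA.toFinset.erase g₀, 0 by simp]
    refine tendsto_finsetSum _ fun g hg => ?_
    have hgne := Finset.ne_of_mem_erase hg
    have hgA : A.coeff g ≠ 0 := by simpa using Finset.mem_of_mem_erase hg
    -- A tie would force `g = g₀`, since all exponents have the same real part `Λ`.
    have hpos : 0 < σ * g.toComplex.im - σ * g₀.toComplex.im := by
      refine lt_of_le_of_ne (sub_nonneg.2 (hmin g (Finset.mem_of_mem_erase hg))) fun hc => hgne ?_
      refine LexExp.ext_re_im ?_ (mul_left_cancel₀ hσ (sub_eq_zero.1 hc.symm))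
      rw [Set.mem_singleton_iff.1 (hΛ g hgA), Set.mem_singleton_iff.1 (hΛ g₀ hg₀')]
    have := ENNReal.Tendsto.const_mul (a := ‖(A.coeff g₀)⁻¹‖ₑ * ‖A.coeff g‖ₑ)
      ((tendsto_eexp_mul hpos).comp Filter.tendsto_neg_atTop_atBot)
      (Or.inr (ENNReal.mul_ne_top enorm_ne_top enorm_ne_top))
    simpa using this
  exact (hlim.eventually_lt_const (u := 4⁻¹) (by simp)).mono fun H hH => hH.le

/-- A priori estimate for a linear equation `∑ A_j δ^j ψ = G` whose coefficients have all their
exponents on the line `Re = Λ`, when one term of `A_n` is dominant. -/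
lemma wnorm_iterate_delta_trunc_le {n : ℕ} {t h Λ M R : ℝ} (ht : t ≤ 0) (hM : 1 ≤ M)
    {A : Fin (n + 1) → FormalSeries} (hA : ∀ j, ReMem {Λ} (A j)) {ψ G : FormalSeries}
    (hψ : ReMem (Set.Ioi M) ψ) (hfin : (trunc R ψ).support.Finite)
    (hG : ∑ j : Fin (n + 1), A j * delta^[(j : ℕ)] ψ = G)
    {g₀ : LexExp} (hg₀ : g₀.toComplex.re = Λ) {a : ℂ} (ha : a ≠ 0) {c : ENNReal}
    (hc : c = ‖a⁻¹‖ₑ * LexExp.weight 0 h (-g₀))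
    (hdom : c * wnorm 0 h (A (Fin.last n) - HahnSeries.single g₀ a) ≤ 4⁻¹)
    (hlow : c * (∑ j : Fin n, wnorm 0 h (A j.castSucc)) * (ENNReal.ofReal M)⁻¹ ≤ 4⁻¹) :
    wnorm t h (delta^[n] (trunc R ψ)) ≤
      2 * (c * eexp (t * -Λ) * wnorm t h (trunc (R + Λ) G)) := by
  set ψR := trunc R ψ with hψR
  set X := wnorm t h (delta^[n] ψR) with hX
  have hX_top : X ≠ ⊤ :=
    wnorm_ne_top_of_finite (hfin.subset (iterate_delta_support_subset n))
  set E := A (Fin.last n) - HahnSeries.single g₀ a with hE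
  have hEΛ : ReMem {Λ} E := (hA _).sub (ReMem.single hg₀)
  have hΛ : ∀ {f}, ReMem {Λ} f → wnorm t h f ≤ eexp (t * Λ) * wnorm 0 h f := fun hf =>
    wnorm_le_of_reMem_Ici ht (hf.mono fun x hx => (Set.mem_singleton_iff.1 hx).ge)
  have hψM : ReMem (Set.Ici M) ψR := hψ.trunc.mono Set.Ioi_subset_Ici_self
  have hM0 : ENNReal.ofReal M ≠ 0 := (ENNReal.ofReal_pos.2 (by linarith)).ne'
  -- Truncation at `R + Λ` passes through each `A j`, becoming truncation of `ψ` at `R`; then only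
  -- the dominant monomial is kept on the left.
  have eq : HahnSeries.single g₀ a * delta^[n] ψR = trunc (R + Λ) G - E * delta^[n] ψR -
      ∑ j : Fin n, A j.castSucc * delta^[(j : ℕ)] ψR := by
    rw [← hG, trunc_sum, Fin.sum_univ_castSucc]
    simp only [trunc_mul_of_reMem_singleton (hA _), ← iterate_delta_trunc, ← hψR,
      Fin.val_castSucc, Fin.val_last, hE]
    ring
  have b₁ : wnorm t h (HahnSeries.single g₀ a * delta^[n] ψR) ≤
      wnorm t h (trunc (R + Λ) G) + eexp (t * Λ) * wnorm 0 h E * X +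
        ∑ j : Fin n, eexp (t * Λ) * wnorm 0 h (A j.castSucc) * ((ENNReal.ofReal M)⁻¹ * X) := by
    rw [eq]
    refine wnorm_sub_le.trans (add_le_add (wnorm_sub_le.trans (add_le_add le_rfl ?_)) ?_)
    · exact wnorm_mul_le.trans (mul_le_mul' (hΛ hEΛ) le_rfl)
    · refine (wnorm_sum_le _ _).trans (Finset.sum_le_sum fun j _ => ?_)
      refine wnorm_mul_le.trans (mul_le_mul' (hΛ (hA _)) ?_)
      rw [mul_comm, ← div_eq_mul_inv, ENNReal.le_div_iff_mul_le (Or.inl hM0)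
        (Or.inl ENNReal.ofReal_ne_top), mul_comm]
      exact mul_wnorm_iterate_delta_le hM hψM j.2
  refine ENNReal.le_two_mul_of_le_add_quarters hX_top ?_
  have hexp : eexp (t * -Λ) * eexp (t * Λ) = 1 := by
    rw [← eexp_add, ← eexp_zero]; ring_nf
  calc X ≤ ‖a⁻¹‖ₑ * LexExp.weight t h (-g₀) *
          wnorm t h (HahnSeries.single g₀ a * delta^[n] ψR) := wnorm_le_single_mul ha
    _ = c * eexp (t * -Λ) * wnorm t h (HahnSeries.single g₀ a * delta^[n] ψR) := by
        rw [LexExp.weight_eq_mul t, LexExp.re_neg, hg₀, hc]; ring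
    _ ≤ c * eexp (t * -Λ) * (wnorm t h (trunc (R + Λ) G) + eexp (t * Λ) * wnorm 0 h E * X +
          ∑ j : Fin n, eexp (t * Λ) * wnorm 0 h (A j.castSucc) * ((ENNReal.ofReal M)⁻¹ * X)) := by
        gcongr
    _ = c * eexp (t * -Λ) * wnorm t h (trunc (R + Λ) G) +
          ((eexp (t * -Λ) * eexp (t * Λ)) * (c * wnorm 0 h E) * X +
          (eexp (t * -Λ) * eexp (t * Λ)) * (c * (∑ j : Fin n, wnorm 0 h (A j.castSucc)) *
            (ENNReal.ofReal M)⁻¹) * X) := by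
        rw [← Finset.sum_mul, ← Finset.mul_sum]; ring
    _ ≤ c * eexp (t * -Λ) * wnorm t h (trunc (R + Λ) G) + (4⁻¹ * X + 4⁻¹ * X) := by
        rw [hexp, one_mul, one_mul]
        gcongr

/-! ### Jets and their increments -/

/-- The substitution point `(x, φ, δφ, …, δ^n φ)`. -/
noncomputable def jet (n : ℕ) (φ : FormalSeries) (v : Option (Fin (n + 1))) : FormalSeries :=
  v.elim X fun j => delta^[(j : ℕ)] φ

/-- The increment of `jet n φ` when `ψ` is added to `φ`. -/
noncomputable def jetIncr (n : ℕ) (ψ : FormalSeries) (v : Option (Fin (n + 1))) : FormalSeries :=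
  v.elim 0 fun j => delta^[(j : ℕ)] ψ

lemma subst_eq_aeval_jet {n : ℕ} (G : MvPolynomial (Option (Fin (n + 1))) ℂ) (φ : FormalSeries) :
    subst G φ = MvPolynomial.aeval (jet n φ) G := rfl

lemma jet_add (n : ℕ) (φ ψ : FormalSeries) :
    jet n (φ + ψ) = fun v => jet n φ v + jetIncr n ψ v := by
  funext v
  cases v with
  | none => simp [jet, jetIncr]
  | some j => exact iterate_delta_add _

lemma ReMem.jet {n : ℕ} {φ : FormalSeries} {I : Set ℝ} (hφ : ReMem I φ) (h1 : (1 : ℝ) ∈ I)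
    (v : Option (Fin (n + 1))) : ReMem I (FormalSeries.jet n φ v) := by
  cases v with
  | none => exact ReMem.single h1
  | some j => exact hφ.iterate_delta _

lemma ReMem.jetIncr {n : ℕ} {ψ : FormalSeries} {I : Set ℝ} (hψ : ReMem I ψ)
    (v : Option (Fin (n + 1))) : ReMem I (FormalSeries.jetIncr n ψ v) := by
  cases v with
  | none => exact ReMem.zero
  | some j => exact hψ.iterate_delta _

lemma finite_support_jet {n : ℕ} {φ : FormalSeries} (hφ : φ.support.Finite)
    (v : Option (Fin (n + 1))) : (jet n φ v).support.Finite := by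
  cases v with
  | none => exact (Set.finite_singleton _).subset HahnSeries.support_single_subset
  | some j => exact hφ.subset (iterate_delta_support_subset _)

lemma jetIncr_trunc {n : ℕ} (R : ℝ) (ψ : FormalSeries) (v : Option (Fin (n + 1))) :
    jetIncr n (trunc R ψ) v = trunc R (jetIncr n ψ v) := by
  cases v with
  | none => exact (trunc_eq_self ReMem.zero).symm
  | some j => exact iterate_delta_trunc _

lemma wnorm_jetIncr_le {n : ℕ} {t h M : ℝ} (hM : 1 ≤ M) {ψ : FormalSeries}
    (hψ : ReMem (Set.Ici M) ψ) (v : Option (Fin (n + 1))) :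
    wnorm t h (jetIncr n ψ v) ≤ wnorm t h (delta^[n] ψ) := by
  cases v with
  | none => exact wnorm_zero.trans_le zero_le
  | some j => exact wnorm_iterate_delta_le hM hψ (Nat.lt_succ_iff.1 j.2)

/-- Any finite partial sum is already contained in some truncation. -/
lemma wnorm_le_of_forall_trunc {t h : ℝ} {f : FormalSeries} {B : ENNReal} {u : ℕ → ℝ}
    (hu : Filter.Tendsto u Filter.atTop Filter.atTop)
    (H : ∀ k, wnorm t h (trunc (u k) f) ≤ B) : wnorm t h f ≤ B := by
  rw [wnorm, ENNReal.tsum_eq_iSup_sum]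
  refine iSup_le fun s => ?_
  have hk : ∀ᶠ k in Filter.atTop, ∀ g ∈ s, g.toComplex.re ≤ u k :=
    (Filter.eventually_all_finset s).2 fun g _ => hu.eventually_ge_atTop _
  obtain ⟨k, hk⟩ := hk.exists
  refine le_trans ?_ ((ENNReal.sum_le_tsum s).trans (H k))
  exact Finset.sum_le_sum fun g hg => by rw [coeff_trunc_of_le (hk g hg)]

end FormalSeries

/-! ### Nonlinear remainder and convergence on a line -/

namespace FormalSeries

/-- Growth and truncation properties of the quadratic Taylor remainder. -/
lemma exists_remainder_bounds {ι : Type*} [Fintype ι] (h b : ℝ)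
    (H : ι → ι → MvPolynomial (ι ⊕ ι) ℂ) :
    ∃ ν₁ : ℝ, ∀ ν ≥ ν₁,
      (∀ (M : ℝ) (p q : ι → FormalSeries), -b ≤ M → (∀ v, ReMem (Set.Ici (-b)) (p v)) →
        (∀ v, ReMem (Set.Ioi M) (q v)) →
        ReMem (Set.Ioi (2 * M - ν))
          (∑ u, ∑ v, MvPolynomial.aeval (Sum.elim p q) (H u v) * (q u * q v))) ∧
      (∀ (M S : ℝ) (p q q' : ι → FormalSeries), 0 ≤ M → -b ≤ M →
        (∀ v, ReMem (Set.Ici (-b)) (p v)) →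
        (∀ v, ReMem (Set.Ioi M) (q v)) → (∀ v, ReMem (Set.Ioi M) (q' v)) →
        (∀ v, ReMem (Set.Ioi S) (q v - q' v)) →
        ReMem (Set.Ioi (S + M - ν))
          (∑ u, ∑ v, MvPolynomial.aeval (Sum.elim p q) (H u v) * (q u * q v) -
           ∑ u, ∑ v, MvPolynomial.aeval (Sum.elim p q') (H u v) * (q' u * q' v))) ∧
      (∀ K : ENNReal, K ≠ ⊤ → ∃ C : ENNReal, C ≠ ⊤ ∧ ∀ t ≤ 0, ∀ (p q : ι → FormalSeries)
        (Y : ENNReal),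
        (∀ v, wnorm t h (p v) ≤ K * eexp (t * -b)) → (∀ v, wnorm t h (q v) ≤ K * eexp (t * -b)) →
        (∀ v, wnorm t h (q v) ≤ Y) →
        wnorm t h (∑ u, ∑ v, MvPolynomial.aeval (Sum.elim p q) (H u v) * (q u * q v)) ≤
          C * eexp (t * -ν) * (Y * Y)) := by
  choose α hα using fun u v => exists_reMem_Ici_aeval (H u v) b
  choose β hβ using fun u v => exists_reMem_Ioi_aeval_sub (H u v) b
  choose γ hγ using fun u v => exists_wnorm_aeval_le h (H u v) b
  obtain ⟨ν₁, hν₁⟩ : ∃ ν₁, ∀ u v, α u v ≤ ν₁ ∧ β u v ≤ ν₁ ∧ γ u v ≤ ν₁ := by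
    have := (Filter.eventually_all (l := Filter.atTop)
      (p := fun u ν₁ => ∀ v, α u v ≤ ν₁ ∧ β u v ≤ ν₁ ∧ γ u v ≤ ν₁)).2 fun u =>
        Filter.eventually_all.2 fun v =>
          (Filter.eventually_ge_atTop _).and
            ((Filter.eventually_ge_atTop _).and (Filter.eventually_ge_atTop _))
    exact this.exists
  have elim_mem : ∀ {M : ℝ} {p q : ι → FormalSeries}, -b ≤ M →
      (∀ v, ReMem (Set.Ici (-b)) (p v)) → (∀ v, ReMem (Set.Ioi M) (q v)) →
      ∀ v, ReMem (Set.Ici (-b)) (Sum.elim p q v) := by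
    rintro M p q hM hp hq (v | v)
    · exact hp v
    · exact (hq v).mono fun x hx => hM.trans (Set.mem_Ioi.1 hx).le
  refine ⟨ν₁, fun ν hν => ⟨?_, ?_, ?_⟩⟩
  · intro M p q hM hp hq
    refine ReMem.sum fun u _ => ReMem.sum fun v _ => ?_
    refine (hα u v ν ((hν₁ u v).1.trans hν) _ (elim_mem hM hp hq)).mul
      (J := Set.Ioi (M + M)) ((hq u).mul (hq v) fun x hx y hy =>
        Set.mem_Ioi.2 (add_lt_add hx hy)) ?_
    · intro x hx y hy
      simp only [Set.mem_Ici, Set.mem_Ioi] at *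
      linarith
  · intro M S p q q' hM0 hM hp hq hq' hqq
    rw [← Finset.sum_sub_distrib]
    simp only [← Finset.sum_sub_distrib]
    refine ReMem.sum fun u _ => ReMem.sum fun v _ => ?_
    have h₁ := hα u v ν ((hν₁ u v).1.trans hν) _ (elim_mem hM hp hq')
    have h₂ : ReMem (Set.Ioi (S - ν)) _ := hβ u v ν ((hν₁ u v).2.1.trans hν) S _ _
      (elim_mem hM hp hq) (elim_mem hM hp hq') (by
        rintro (v | v)
        · simpa using ReMem.zero
        · exact hqq v)
    -- Telescoping: each summand has one difference, beyond `S` up to the loss `ν`, and at least one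
    -- further factor beyond `M`.
    have e : MvPolynomial.aeval (Sum.elim p q) (H u v) * (q u * q v) -
        MvPolynomial.aeval (Sum.elim p q') (H u v) * (q' u * q' v) =
        (MvPolynomial.aeval (Sum.elim p q) (H u v) - MvPolynomial.aeval (Sum.elim p q') (H u v)) *
          (q u * q v) +
        MvPolynomial.aeval (Sum.elim p q') (H u v) * ((q u - q' u) * q v) +
        MvPolynomial.aeval (Sum.elim p q') (H u v) * (q' u * (q v - q' v)) := by ring
    rw [e]
    refine ReMem.add (ReMem.add ?_ ?_) ?_
    · refine h₂.mul (J := Set.Ioi (M + M))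
        ((hq u).mul (hq v) fun x hx y hy => Set.mem_Ioi.2 (add_lt_add hx hy)) fun x hx y hy => ?_
      simp only [Set.mem_Ioi] at *
      linarith
    · refine h₁.mul (J := Set.Ioi (S + M))
        ((hqq u).mul (hq v) fun x hx y hy => Set.mem_Ioi.2 (add_lt_add hx hy)) fun x hx y hy => ?_
      simp only [Set.mem_Ici, Set.mem_Ioi] at *
      linarith
    · refine h₁.mul (J := Set.Ioi (M + S))
        ((hq' u).mul (hqq v) fun x hx y hy => Set.mem_Ioi.2 (add_lt_add hx hy)) fun x hx y hy => ?_
      simp only [Set.mem_Ici, Set.mem_Ioi] at *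
      linarith
  · intro K hK
    choose C hC HC using fun u v => hγ u v ν ((hν₁ u v).2.2.trans hν) K hK
    refine ⟨∑ u, ∑ v, C u v, ENNReal.sum_ne_top.2 fun u _ => ENNReal.sum_ne_top.2 fun v _ => hC u v,
      fun t ht p q Y hp hq hY => ?_⟩
    simp only [Finset.sum_mul]
    refine (wnorm_sum_le _ _).trans (Finset.sum_le_sum fun u _ => ?_)
    refine (wnorm_sum_le _ _).trans (Finset.sum_le_sum fun v _ => ?_)
    refine wnorm_mul_le.trans (mul_le_mul' (HC u v t ht _ ?_) (wnorm_mul_le.trans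
      (mul_le_mul' (hY u) (hY v))))
    rintro (w | w)
    · exact hp w
    · exact hq w

lemma exists_reMem_Ioi_subst_sub_trunc {n : ℕ} (G : MvPolynomial (Option (Fin (n + 1))) ℂ) {b : ℝ}
    (hb : 0 ≤ b) :
    ∃ ν₁ : ℝ, ∀ ν ≥ ν₁, ∀ φ : FormalSeries, ReMem (Set.Ici (-b)) φ → ∀ M,
      ReMem (Set.Ioi (M - ν)) (subst G φ - subst G (trunc M φ)) := by
  obtain ⟨ν₁, hν₁⟩ := exists_reMem_Ioi_aeval_sub G b
  have h1b : (1 : ℝ) ∈ Set.Ici (-b) := by simp only [Set.mem_Ici]; linarith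
  refine ⟨ν₁, fun ν hν φ hφ M => ?_⟩
  refine hν₁ ν hν M (jet n φ) (jet n (trunc M φ)) (hφ.jet h1b) (hφ.trunc.jet h1b) fun v => ?_
  have e : jet n φ v - jet n (trunc M φ) v = jetIncr n (φ - trunc M φ) v := by
    conv_lhs => rw [← add_sub_cancel (trunc M φ) φ, jet_add]
    rw [add_sub_cancel (trunc M φ) φ, add_sub_cancel_left]
  rw [e]
  exact reMem_Ioi_sub_trunc.jetIncr v

/-- Up to real part `R` the substituted series agrees with its value at a truncation of `φ`, which
is a polynomial in finite sums. -/
lemma finite_support_trunc_subst {n : ℕ} {φ : FormalSeries}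
    (hfin : ∀ R, (trunc R φ).support.Finite) {b : ℝ} (hφ : ReMem (Set.Ici (-b)) φ) (hb : 0 ≤ b)
    (G : MvPolynomial (Option (Fin (n + 1))) ℂ) (R : ℝ) :
    (trunc R (subst G φ)).support.Finite := by
  obtain ⟨ν, hν⟩ := exists_reMem_Ioi_subst_sub_trunc G hb
  have h := hν ν le_rfl φ hφ (R + ν)
  rw [add_sub_cancel_right] at h
  rw [trunc_congr h]
  refine (finite_support_aeval G (finite_support_jet (hfin (R + ν)))).subset fun g hg => ?_
  rcases coeff_trunc_eq_or g with h0 | h0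
  · exact fun hc => hg (h0.trans hc)
  · exact absurd h0 hg

/-- A formal solution is convergent with respect to the weighted norms on a line `Im log x = h` on
which one term of the leading part of `∂F/∂y_n` is dominant. -/
theorem exists_wnorm_ne_top {n : ℕ} (F : MvPolynomial (Option (Fin (n + 1))) ℂ)
    {φ : FormalSeries} (hfin : ∀ R, (trunc R φ).support.Finite) {b₀ : ℝ}
    (hb₀ : ReMem (Set.Ici (-b₀)) φ) (hsol : subst F φ = 0) {Λ h : ℝ}
    (hA : ∀ j : Fin (n + 1), ReMem (Set.Ici Λ) (subst (MvPolynomial.pderiv (some j) F) φ))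
    {g₀ : LexExp} (hg₀ : g₀.toComplex.re = Λ) {a : ℂ} (ha : a ≠ 0)
    (hdom : ‖a⁻¹‖ₑ * LexExp.weight 0 h (-g₀) *
      wnorm 0 h (trunc Λ (subst (MvPolynomial.pderiv (some (Fin.last n)) F) φ) -
        HahnSeries.single g₀ a) ≤ 4⁻¹) :
    ∃ T : ℝ, ∀ t ≤ T, wnorm t h φ ≠ ⊤ := by
  classical
  -- Nonnegativity of `b` makes the exponent `1` of `x` obey the same lower bound `-b` as `φ`.
  set b := max b₀ 0 with hb
  have hb0 : 0 ≤ b := le_max_right _ _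
  have hφb : ReMem (Set.Ici (-b)) φ :=
    hb₀.mono (Set.Ici_subset_Ici.2 (neg_le_neg (le_max_left _ _)))
  have h1b : (1 : ℝ) ∈ Set.Ici (-b) := by simp only [Set.mem_Ici]; linarith
  obtain ⟨H, hH⟩ := F.exists_taylor_two
  obtain ⟨ν₁, hν₁⟩ := exists_remainder_bounds h b H
  choose β hβ using fun j : Fin (n + 1) =>
    exists_reMem_Ioi_subst_sub_trunc (MvPolynomial.pderiv (some j) F) hb0
  obtain ⟨ν, hν⟩ : ∃ ν, ν₁ ≤ ν ∧ ∀ j, β j ≤ ν :=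
    ((Filter.eventually_ge_atTop ν₁).and
      (Filter.eventually_all.2 fun j => Filter.eventually_ge_atTop (β j))).exists
  obtain ⟨hQ_mem, hQ_trunc, hQ_norm⟩ := hν₁ ν hν.1
  -- The leading parts of the partial derivatives.
  set A : Fin (n + 1) → FormalSeries :=
    fun j => trunc Λ (subst (MvPolynomial.pderiv (some j) F) φ) with hAdef
  have hAΛ : ∀ j, ReMem {Λ} (A j) := fun j g hg =>
    le_antisymm (reMem_Iic_trunc g hg) ((hA j).trunc g hg)
  have hjet : ∀ R v, ReMem (Set.Ici (-b)) (jet n (trunc R φ) v) := fun R => hφb.trunc.jet h1b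
  have hsub : ∀ M j, ReMem (Set.Ioi (M - ν)) (subst (MvPolynomial.pderiv (some j) F) φ -
      subst (MvPolynomial.pderiv (some j) F) (trunc M φ)) := fun M j =>
    hβ j ν (hν.2 j) φ hφb M
  have hA_eq : ∀ M, Λ ≤ M - ν → ∀ j,
      A j = trunc Λ (subst (MvPolynomial.pderiv (some j) F) (trunc M φ)) := fun M hM j =>
    trunc_congr ((hsub M j).mono (Set.Ioi_subset_Ioi hM))
  have hfinP : ∀ M (G : MvPolynomial (Option (Fin (n + 1))) ℂ),
      (subst G (trunc M φ)).support.Finite := fun M G =>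
    finite_support_aeval G (finite_support_jet (hfin M))
  have hA_fin : ∀ j, (A j).support.Finite := fun j => finite_support_trunc_subst hfin hφb hb0 _ Λ
  -- The cut between the initial part and the tail of the solution.
  set c := ‖a⁻¹‖ₑ * LexExp.weight 0 h (-g₀) with hc
  have hc_top : c ≠ ⊤ := ENNReal.mul_ne_top enorm_ne_top (LexExp.weight_ne_top _ _ _)
  -- A large `M` makes the lower-order terms negligible and pays for the losses `Λ` and `ν`. The
  -- spare `2` covers `μ = M - 1` and `ε ≤ 1`.
  obtain ⟨M, hM1, hMν, hM0, hlow⟩ : ∃ M : ℝ, 1 ≤ M ∧ |Λ| + |ν| + 2 ≤ M ∧ 0 ≤ M ∧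
      c * (∑ j : Fin n, wnorm 0 h (A j.castSucc)) * (ENNReal.ofReal M)⁻¹ ≤ 4⁻¹ := by
    have h0 : Filter.Tendsto (fun M : ℝ => c * (∑ j : Fin n, wnorm 0 h (A j.castSucc)) *
        (ENNReal.ofReal M)⁻¹) Filter.atTop (nhds 0) := by
      have := ENNReal.Tendsto.const_mul (a := c * (∑ j : Fin n, wnorm 0 h (A j.castSucc)))
        (tendsto_inv_iff.2 ENNReal.tendsto_ofReal_atTop)
        (Or.inr (ENNReal.mul_ne_top hc_top (ENNReal.sum_ne_top.2 fun j _ =>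
          wnorm_ne_top_of_finite (hA_fin _))))
      simpa using this
    obtain ⟨M, h1, h2, h3⟩ := ((Filter.eventually_ge_atTop (1 : ℝ)).and
      ((Filter.eventually_ge_atTop (|Λ| + |ν| + 2)).and
        (h0.eventually_lt_const (u := 4⁻¹) (by simp)))).exists
    exact ⟨M, h1, h2, by linarith, h3.le⟩
  have hΛ' := abs_le.1 (le_refl |Λ|)
  have hν' := abs_le.1 (le_refl |ν|)
  have hbM : -b ≤ M := by linarith
  set P := trunc M φ with hP
  set ψ := φ - P with hψdef
  have hψ : ReMem (Set.Ioi M) ψ := reMem_Ioi_sub_trunc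
  have hPψ : P + ψ = φ := add_sub_cancel _ _
  set D : Fin (n + 1) → FormalSeries := fun j => subst (MvPolynomial.pderiv (some j) F) P with hD
  set B : Fin (n + 1) → FormalSeries := fun j => D j - A j with hB
  set Q : FormalSeries → FormalSeries := fun χ =>
    ∑ u, ∑ v, MvPolynomial.aeval (Sum.elim (jet n P) (jetIncr n χ)) (H u v) *
      (jetIncr n χ u * jetIncr n χ v) with hQ
  have hMΛ : Λ ≤ M - ν := by linarith
  have hB_mem : ∀ j, ReMem (Set.Ioi Λ) (B j) := fun j => by
    rw [hB]; simp only [hA_eq M hMΛ j]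
    exact reMem_Ioi_sub_trunc
  have hB_fin : ∀ j, (B j).support.Finite := fun j => by
    simp only [hB, sub_eq_add_neg]
    exact finite_support_add (hfinP _ _) (by rw [HahnSeries.support_neg]; exact hA_fin j)
  -- Finitely many exponents strictly beyond `Λ` leave a gap, which becomes the step of the
  -- bootstrap.
  obtain ⟨ε, hε, hε1, hBε⟩ : ∃ ε : ℝ, 0 < ε ∧ ε ≤ 1 ∧ ∀ j, ReMem (Set.Ici (Λ + ε)) (B j) := by
    choose ε hε hBε using fun j => exists_reMem_Ici_of_finite (hB_fin j) (hB_mem j)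
    have : ∀ᶠ e in nhdsWithin (0 : ℝ) (Set.Ioi 0), ∀ j, e < ε j :=
      Filter.eventually_all.2 fun j =>
        Filter.mem_of_superset (Ioo_mem_nhdsGT (hε j)) fun e he => he.2
    obtain ⟨e, h1, h2, h3⟩ := (this.and (Filter.Eventually.and (Ioo_mem_nhdsGT one_pos) self_mem_nhdsWithin)).exists
    exact ⟨e, h3, h2.2.le, fun j => (hBε j).mono (Set.Ici_subset_Ici.2 (by linarith [h1 j]))⟩
  have taylor : subst F P + (∑ j : Fin (n + 1), D j * delta^[(j : ℕ)] ψ) + Q ψ = 0 := by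
    rw [← hsol, ← hPψ, subst_eq_aeval_jet F (P + ψ), jet_add, hH, Fintype.sum_option]
    simp [hQ, hD, jetIncr, subst_eq_aeval_jet]
  have hAψ : ∑ j : Fin (n + 1), A j * delta^[(j : ℕ)] ψ =
      -(subst F P) - (∑ j : Fin (n + 1), B j * delta^[(j : ℕ)] ψ) - Q ψ := by
    simp only [hB, sub_mul, Finset.sum_sub_distrib]
    linear_combination taylor
  -- By the equation, `F(P)` cancels the linear and quadratic terms in `ψ`, so it starts no earlier
  -- than they do.
  have hFP_mem : ReMem (Set.Ici (Λ + M)) (subst F P) := by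
    have e : subst F P = -(∑ j : Fin (n + 1), D j * delta^[(j : ℕ)] ψ) - Q ψ := by
      linear_combination taylor
    rw [e]
    refine ReMem.sub (ReMem.neg (ReMem.sum fun j _ => ?_)) ?_
    · have hDj : ReMem (Set.Ici Λ) (D j) := by
        have : D j = A j + B j := by simp [hB]
        rw [this]
        exact ((hA j).trunc).add ((hB_mem j).mono Set.Ioi_subset_Ici_self)
      refine hDj.mul (hψ.iterate_delta _) fun x hx y hy => ?_
      simp only [Set.mem_Ici, Set.mem_Ioi] at *
      linarith
    · refine (hQ_mem M _ _ hbM (hjet M) hψ.jetIncr).mono fun x hx => ?_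
      simp only [Set.mem_Ici, Set.mem_Ioi] at *
      linarith
  -- The truncated equation.
  have htr : ∀ R, trunc (R + Λ) (-(subst F P) -
      (∑ j : Fin (n + 1), B j * delta^[(j : ℕ)] ψ) - Q ψ) =
      trunc (R + Λ) (-(subst F P) -
        (∑ j : Fin (n + 1), B j * delta^[(j : ℕ)] (trunc (R - ε) ψ)) - Q (trunc (R - ε) ψ)) := by
    intro R
    refine trunc_congr ?_
    have e : ∀ x y y' z z' : FormalSeries,
        x - y - z - (x - y' - z') = -(y - y') - (z - z') := fun _ _ _ _ _ => by ring
    rw [e, ← Finset.sum_sub_distrib]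
    refine ReMem.sub (ReMem.neg (ReMem.sum fun j _ => ?_)) ?_
    -- What is discarded lies beyond `R - ε`, and `B j` moves it beyond `R + Λ`.
    · rw [← mul_sub, iterate_delta_trunc]
      refine (hBε j).mul reMem_Ioi_sub_trunc fun x hx y hy => ?_
      simp only [Set.mem_Ici, Set.mem_Ioi] at *
      linarith
    · refine (hQ_trunc M (R - ε) _ _ _ hM0 hbM (hjet M) hψ.jetIncr hψ.trunc.jetIncr
        fun v => ?_).mono fun x hx => ?_
      · rw [jetIncr_trunc]
        exact reMem_Ioi_sub_trunc
      · simp only [Set.mem_Ioi] at *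
        linarith
  -- Constants.
  set μ := M - 1 with hμ
  -- One `K` must serve both arguments of the remainder: the sum bounds `jet n P`, the `1` bounds
  -- the increments.
  set K : ENNReal := 1 + ∑ v, wnorm 0 h (jet n P v) with hK
  have hK_top : K ≠ ⊤ := ENNReal.add_ne_top.2 ⟨ENNReal.one_ne_top, ENNReal.sum_ne_top.2
    fun v _ => wnorm_ne_top_of_finite (finite_support_jet (hfin M) v)⟩
  obtain ⟨C, hC_top, hC⟩ := hQ_norm K hK_top
  set L : ENNReal := wnorm 0 h (subst F P) + (∑ j, wnorm 0 h (B j)) + C with hL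
  have hL_top : L ≠ ⊤ := ENNReal.add_ne_top.2 ⟨ENNReal.add_ne_top.2
    ⟨wnorm_ne_top_of_finite (hfinP _ _),
      ENNReal.sum_ne_top.2 fun j _ => wnorm_ne_top_of_finite (hB_fin j)⟩, hC_top⟩
  -- The factor `eexp (t * ε)` outweighs all constants, so that the induction below reproduces its
  -- own bound.
  obtain ⟨T, hT⟩ : ∃ T : ℝ, ∀ t ≤ T, t ≤ 0 ∧ 2 * (c * L) * eexp (t * ε) ≤ 1 := by
    have h0 : Filter.Tendsto (fun t => 2 * (c * L) * eexp (t * ε)) Filter.atBot (nhds 0) := by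
      have := ENNReal.Tendsto.const_mul (a := 2 * (c * L)) (tendsto_eexp_mul hε)
        (Or.inr (ENNReal.mul_ne_top ENNReal.ofNat_ne_top (ENNReal.mul_ne_top hc_top hL_top)))
      simpa using this
    exact Filter.eventually_atBot.1 ((Filter.eventually_le_atBot 0).and
      ((h0.eventually_lt_const (u := 1) (by simp)).mono fun t ht => ht.le))
  have hψfin : ∀ R, (trunc R ψ).support.Finite := by
    intro R
    refine (hfin R).subset fun g hg => ?_
    rcases le_or_gt g.toComplex.re R with hgR | hgR
    · have h1 : ψ.coeff g ≠ 0 := by rwa [HahnSeries.mem_support, coeff_trunc_of_le hgR] at hg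
      have h2 : P.coeff g = 0 := coeff_trunc_of_lt (hψ g h1)
      rw [HahnSeries.mem_support, coeff_trunc_of_le hgR]
      simpa [hψdef, h2] using h1
    · exact absurd (coeff_trunc_of_lt hgR) hg
  refine ⟨T, fun t ht => ?_⟩
  obtain ⟨ht0, htT⟩ := hT t ht
  have hψM : ∀ {R}, ReMem (Set.Ici M) (trunc R ψ) := hψ.trunc.mono Set.Ioi_subset_Ici_self
  -- The bound does not depend on `k`. Taking `μ = M - 1` instead of `M` leaves room for the source
  -- term `F(P)`, since `M ≥ μ + ε`.
  have bootstrap : ∀ k : ℕ, wnorm t h (delta^[n] (trunc (M + k * ε) ψ)) ≤ eexp (t * μ) := by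
    intro k
    induction k with
    | zero =>
      rw [iterate_delta_trunc, trunc_eq_zero (by simpa using hψ.iterate_delta n), wnorm_zero]
      exact zero_le
    | succ k ih =>
      set R := M + ((k + 1 : ℕ) : ℝ) * ε with hR
      set χ := trunc (R - ε) ψ with hχ
      have hRε : R - ε = M + k * ε := by rw [hR]; push_cast; ring
      rw [← hRε, ← hχ] at ih
      have hχv : ∀ v, wnorm t h (jetIncr n χ v) ≤ eexp (t * μ) := fun v =>
        (wnorm_jetIncr_le hM1 hψM v).trans ih
      have hrhs : eexp (t * -Λ) * wnorm t h (-(subst F P) -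
          (∑ j : Fin (n + 1), B j * delta^[(j : ℕ)] χ) - Q χ) ≤
          L * (eexp (t * ε) * eexp (t * μ)) := by
        have n₁ : eexp (t * -Λ) * wnorm t h (-(subst F P)) ≤
            wnorm 0 h (subst F P) * (eexp (t * ε) * eexp (t * μ)) := by
          rw [wnorm_neg]
          refine (mul_le_mul' le_rfl (wnorm_le_of_reMem_Ici ht0 hFP_mem)).trans ?_
          rw [← mul_assoc, ← eexp_add, mul_comm, ← eexp_add]
          gcongr
          exact eexp_mono (by rw [hμ]; nlinarith)
        have n₂ : eexp (t * -Λ) * wnorm t h (∑ j : Fin (n + 1), B j * delta^[(j : ℕ)] χ) ≤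
            (∑ j, wnorm 0 h (B j)) * (eexp (t * ε) * eexp (t * μ)) := by
          rw [Finset.sum_mul]
          refine (mul_le_mul' le_rfl (wnorm_sum_le _ _)).trans ?_
          rw [Finset.mul_sum]
          refine Finset.sum_le_sum fun j _ => ?_
          calc eexp (t * -Λ) * wnorm t h (B j * delta^[(j : ℕ)] χ)
              ≤ eexp (t * -Λ) * (eexp (t * (Λ + ε)) * wnorm 0 h (B j) * eexp (t * μ)) := by
                gcongr
                exact wnorm_mul_le.trans
                  (mul_le_mul' (wnorm_le_of_reMem_Ici ht0 (hBε j)) (hχv (some j)))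
            _ = wnorm 0 h (B j) * ((eexp (t * -Λ) * eexp (t * (Λ + ε))) * eexp (t * μ)) := by ring
            _ = _ := by rw [← eexp_add]; ring_nf
        have n₃ : eexp (t * -Λ) * wnorm t h (Q χ) ≤ C * (eexp (t * ε) * eexp (t * μ)) := by
          have hq := hC t ht0 (jet n P) (jetIncr n χ) (eexp (t * μ)) (fun v => ?_) (fun v => ?_) hχv
          · refine (mul_le_mul' le_rfl hq).trans ?_
            calc eexp (t * -Λ) * (C * eexp (t * -ν) * (eexp (t * μ) * eexp (t * μ)))
                = C * (eexp (t * -Λ) * (eexp (t * -ν) * (eexp (t * μ) * eexp (t * μ)))) := by ring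
              _ ≤ C * (eexp (t * ε) * eexp (t * μ)) := by
                simp only [← eexp_add]
                gcongr
                refine eexp_mono ?_
                -- The quadratic term has a whole factor `eexp (t * μ)` to spare, enough to cover `Λ
                -- + ν + ε`.
                have : t * (μ - Λ - ν - ε) ≤ 0 :=
                  mul_nonpos_of_nonpos_of_nonneg ht0 (by rw [hμ]; linarith)
                linarith
          · refine (wnorm_le_of_reMem_Ici ht0 (hjet M v)).trans ?_
            rw [mul_comm]
            gcongr
            exact (Finset.single_le_sum (f := fun v => wnorm 0 h (jet n P v))
              (fun _ _ => zero_le) (Finset.mem_univ v)).trans le_add_self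
          · refine (hχv v).trans ?_
            rw [← one_mul (eexp (t * μ))]
            refine mul_le_mul' le_self_add (eexp_mono (mul_le_mul_of_nonpos_left ?_ ht0))
            rw [hμ]; linarith
        calc _ ≤ eexp (t * -Λ) * (wnorm t h (-(subst F P)) +
              wnorm t h (∑ j : Fin (n + 1), B j * delta^[(j : ℕ)] χ) + wnorm t h (Q χ)) := by
              gcongr
              exact wnorm_sub_le.trans (add_le_add wnorm_sub_le le_rfl)
          _ ≤ _ := by
              rw [mul_add, mul_add, hL, add_mul, add_mul]
              exact add_le_add (add_le_add n₁ n₂) n₃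
      have hlin := wnorm_iterate_delta_trunc_le (t := t) (R := R) ht0 hM1 hAΛ hψ (hψfin R) hAψ hg₀
        ha hc hdom hlow
      rw [htr R] at hlin
      refine hlin.trans ?_
      calc 2 * (c * eexp (t * -Λ) * wnorm t h (trunc (R + Λ) (-(subst F P) -
            (∑ j : Fin (n + 1), B j * delta^[(j : ℕ)] χ) - Q χ)))
          ≤ 2 * (c * (eexp (t * -Λ) * wnorm t h (-(subst F P) -
            (∑ j : Fin (n + 1), B j * delta^[(j : ℕ)] χ) - Q χ))) := by
            rw [mul_assoc c]
            gcongr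
            exact wnorm_trunc_le
        _ ≤ 2 * (c * (L * (eexp (t * ε) * eexp (t * μ)))) := by gcongr
        _ = 2 * (c * L) * eexp (t * ε) * eexp (t * μ) := by ring
        _ ≤ 1 * eexp (t * μ) := by gcongr
        _ = eexp (t * μ) := one_mul _
  have hψ_top : wnorm t h ψ ≤ eexp (t * μ) := by
    refine (wnorm_iterate_delta_le (i := 0) hM1 (hψ.mono Set.Ioi_subset_Ici_self)
      (Nat.zero_le n)).trans ?_
    refine wnorm_le_of_forall_trunc (u := fun k : ℕ => M + k * ε) ?_ fun k => ?_
    · exact Filter.tendsto_atTop_add_const_left _ _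
        (tendsto_natCast_atTop_atTop.atTop_mul_const hε)
    · rw [← iterate_delta_trunc]
      exact bootstrap k
  rw [← hPψ]
  exact ne_top_of_le_ne_top (ENNReal.add_ne_top.2 ⟨wnorm_ne_top_of_finite (hfin M),
    ne_top_of_le_ne_top (eexp_ne_top _) hψ_top⟩) wnorm_add_le

end FormalSeries

/-! ### From weighted norms to absolutely convergent series -/

namespace FormalSeries

lemma coeff_ofSeq (c s : ℕ → ℂ) (hs : StrictMono fun k => LexExp.ofComplex (s k)) (k : ℕ) :
    (ofSeq c s hs).coeff (LexExp.ofComplex (s k)) = c k := by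
  have := HahnSeries.embDomain_coeff (f := OrderEmbedding.ofStrictMono _ hs)
    (x := HahnSeries.toPowerSeries.symm (PowerSeries.mk c)) (a := k)
  rw [HahnSeries.coeff_toPowerSeries_symm, PowerSeries.coeff_mk] at this
  exact this

lemma exists_of_coeff_ofSeq_ne_zero {c s : ℕ → ℂ}
    {hs : StrictMono fun k => LexExp.ofComplex (s k)} {g : LexExp}
    (hg : (ofSeq c s hs).coeff g ≠ 0) : ∃ k, g = LexExp.ofComplex (s k) := by
  by_contra! hc
  refine hg (HahnSeries.embDomain_of_notMem_range ?_)
  rintro ⟨k, hk⟩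
  exact hc k hk.symm

lemma finite_support_trunc_ofSeq {c s : ℕ → ℂ}
    (hs : StrictMono fun k => LexExp.ofComplex (s k))
    (hlim : Filter.Tendsto (fun k => (s k).re) Filter.atTop Filter.atTop) (R : ℝ) :
    (trunc R (ofSeq c s hs)).support.Finite := by
  have hfin : {k | (s k).re ≤ R}.Finite := by
    have := hlim.eventually_gt_atTop R
    rw [← Nat.cofinite_eq_atTop, Filter.eventually_cofinite] at this
    simpa using this
  refine (hfin.image fun k => LexExp.ofComplex (s k)).subset fun g hg => ?_
  have hgR : g.toComplex.re ≤ R := reMem_Iic_trunc g hg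
  have hg' : (ofSeq c s hs).coeff g ≠ 0 := by
    rwa [HahnSeries.mem_support, coeff_trunc_of_le hgR] at hg
  obtain ⟨k, rfl⟩ := exists_of_coeff_ofSeq_ne_zero hg'
  exact ⟨k, hgR, rfl⟩

lemma reMem_ofSeq {c s : ℕ → ℂ} (hs : StrictMono fun k => LexExp.ofComplex (s k)) :
    ReMem (Set.Ici (s 0).re) (ofSeq c s hs) := by
  intro g hg
  obtain ⟨k, rfl⟩ := exists_of_coeff_ofSeq_ne_zero hg
  exact LexExp.re_le_re (hs.monotone (Nat.zero_le k))

lemma summable_of_wnorm_ofSeq_ne_top {c s : ℕ → ℂ}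
    {hs : StrictMono fun k => LexExp.ofComplex (s k)} {t h : ℝ}
    (H : wnorm t h (ofSeq c s hs) ≠ ⊤) :
    Summable fun k => ‖c k‖ * Real.exp (t * (s k).re - h * (s k).im) := by
  have h1 : ∑' k, ‖c k‖ₑ * LexExp.weight t h (LexExp.ofComplex (s k)) ≠ ⊤ := by
    refine ne_top_of_le_ne_top H ?_
    refine le_trans (le_of_eq (tsum_congr fun k => ?_)) (ENNReal.tsum_comp_le_tsum_of_injective
      hs.injective fun g => ‖(ofSeq c s hs).coeff g‖ₑ * LexExp.weight t h g)
    rw [coeff_ofSeq c s hs k]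
  refine (ENNReal.summable_toReal h1).congr fun k => ?_
  rw [ENNReal.toReal_mul, toReal_enorm, LexExp.weight, eexp,
    ENNReal.toReal_ofReal (Real.exp_pos _).le]
  rfl

/-- The lexicographic order enters only here: comparing orders bounds the real parts of all
`∂F/∂y_j` below by `Λ`. Stated for all large `H`, so that `σ = 1` and `σ = -1` can use the same `H`.
-/
lemma exists_forall_summable {n : ℕ} (F : MvPolynomial (Option (Fin (n + 1))) ℂ) {c s : ℕ → ℂ}
    (hs : StrictMono fun k => LexExp.ofComplex (s k))
    (hlim : Filter.Tendsto (fun k => (s k).re) Filter.atTop Filter.atTop)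
    (hsol : subst F (ofSeq c s hs) = 0)
    (hne : subst (MvPolynomial.pderiv (some (Fin.last n)) F) (ofSeq c s hs) ≠ 0)
    (hord : ∀ j : Fin (n + 1),
      (subst (MvPolynomial.pderiv (some (Fin.last n)) F) (ofSeq c s hs)).orderTop ≤
      (subst (MvPolynomial.pderiv (some j) F) (ofSeq c s hs)).orderTop)
    {σ : ℝ} (hσ : σ ≠ 0) :
    ∀ᶠ H in Filter.atTop, ∃ T : ℝ, ∀ t ≤ T,
      Summable fun k => ‖c k‖ * Real.exp (t * (s k).re - σ * H * (s k).im) := by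
  set φ := ofSeq c s hs with hφ
  set D := subst (MvPolynomial.pderiv (some (Fin.last n)) F) φ with hD
  obtain ⟨lam, hlam⟩ := WithTop.ne_top_iff_exists.1 (HahnSeries.orderTop_ne_top.2 hne)
  set Λ := lam.toComplex.re with hΛ
  have hA : ∀ j : Fin (n + 1), ReMem (Set.Ici Λ) (subst (MvPolynomial.pderiv (some j) F) φ) := by
    intro j g hg
    refine LexExp.re_le_re (WithTop.coe_le_coe.1 ?_)
    rw [hlam]
    exact (hord j).trans (HahnSeries.orderTop_le_of_coeff_ne_zero hg)
  have hfin := finite_support_trunc_ofSeq (c := c) hs hlim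
  have hb : ReMem (Set.Ici (-|(s 0).re|)) φ :=
    (reMem_ofSeq hs).mono (Set.Ici_subset_Ici.2 (neg_abs_le _))
  -- The leading exponent `lam` has real part exactly `Λ`, so its coefficient survives the
  -- truncation.
  have hA₀ : trunc Λ D ≠ 0 := by
    intro h0
    have h1 : D.coeff lam ≠ 0 := HahnSeries.coeff_orderTop_ne hlam.symm
    rw [← coeff_trunc_of_le (R := Λ) hΛ.ge, h0] at h1
    exact h1 rfl
  have hAΛ : ReMem {Λ} (trunc Λ D) := fun g hg =>
    le_antisymm (reMem_Iic_trunc g hg) ((hA _).trunc g hg)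
  have hAfin : (trunc Λ D).support.Finite := finite_support_trunc_subst hfin hb (abs_nonneg _) _ Λ
  obtain ⟨g₀, hg₀, hdom⟩ := exists_dominant_term hAfin hA₀ hAΛ σ hσ
  filter_upwards [hdom] with H hH
  obtain ⟨T, hT⟩ := exists_wnorm_ne_top F hfin hb hsol hA (hAΛ g₀ hg₀) hg₀ hH
  exact ⟨T, fun t ht => summable_of_wnorm_ofSeq_ne_top (hT t ht)⟩

end FormalSeries

/-! ### Logarithm branches on a sector and the conclusion -/

/-- The imaginary part of a branch of the logarithm is bounded on a sector. -/
lemma IsLogBranchOn.exists_abs_im_le {ℓ : ℂ → ℂ} {α β : ℝ}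
    (hℓ : IsLogBranchOn ℓ (openSector α β)) :
    ∃ B : ℝ, ∀ x ∈ openSector α β, |(ℓ x).im| ≤ B := by
  set S : Set (ℝ × ℝ) := Set.Ioi 0 ×ˢ Set.Ioo α β with hS
  set e : ℝ × ℝ → ℂ := fun p => p.1 * Complex.exp (p.2 * Complex.I) with he
  have heS : Set.MapsTo e S (openSector α β) := fun p hp =>
    ⟨p.1, p.2, hp.1, hp.2.1, hp.2.2, rfl⟩
  have hconn : IsPreconnected S := ((convex_Ioi 0).prod (convex_Ioo α β)).isPreconnected
  -- The imaginary part of `ℓ` and the angle differ by `2π` times an integer; continuity on a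
  -- connected parameter strip makes it constant.
  set w : ℝ × ℝ → ℝ := fun p => ((ℓ (e p)).im - p.2) / (2 * Real.pi) with hw
  have hwc : ContinuousOn w S := by
    have h1 : ContinuousOn (fun p => ℓ (e p)) S :=
      hℓ.1.comp (by rw [he]; fun_prop) heS
    exact ((Complex.continuous_im.comp_continuousOn h1).sub continuous_snd.continuousOn).div_const _
  have hwZ : Set.MapsTo w S (Set.range ((↑) : ℤ → ℝ)) := by
    intro p hp
    have hp1 : (0 : ℝ) < p.1 := hp.1
    have h1 : Complex.exp (ℓ (e p)) = Complex.exp (Real.log p.1 + p.2 * Complex.I) := by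
      rw [hℓ.2 _ (heS hp), Complex.exp_add, ← Complex.ofReal_exp, Real.exp_log hp1]
    obtain ⟨m, hm⟩ := Complex.exp_eq_exp_iff_exists_int.1 h1
    refine ⟨m, ?_⟩
    have h2 := congrArg Complex.im hm
    simp at h2
    rw [hw]
    simp only [h2]
    field_simp
    ring
  have hdisc : IsDiscrete (Set.range ((↑) : ℤ → ℝ)) := by
    refine ⟨?_⟩
    have := Int.isClosedEmbedding_coe_real.isEmbedding.toHomeomorph.symm.isEmbedding
    exact this.discreteTopology
  obtain ⟨y, -, hy⟩ := hconn.eqOn_const_of_mapsTo hdisc hwc hwZ ⟨_, 0, rfl⟩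
  refine ⟨|2 * Real.pi * y| + (|α| + |β|), ?_⟩
  rintro x ⟨ρ, θ, hρ, hα, hβ, rfl⟩
  have h1 : w (ρ, θ) = y := hy (⟨hρ, hα, hβ⟩ : (ρ, θ) ∈ S)
  have h2 : (ℓ (ρ * Complex.exp (θ * Complex.I))).im = 2 * Real.pi * y + θ := by
    rw [← h1, hw]
    simp only [he]
    field_simp
    ring
  rw [h2]
  refine (abs_add_le _ _).trans (add_le_add le_rfl ?_)
  rw [abs_le]
  constructor
  · linarith [neg_abs_le α, abs_nonneg β]
  · linarith [le_abs_self β, abs_nonneg α]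

theorem theorem1 (n : ℕ) (F : MvPolynomial (Option (Fin (n + 1))) ℂ) (c s : ℕ → ℂ)
    (hs : StrictMono fun k => LexExp.ofComplex (s k))
    (hlim : Filter.Tendsto (fun k => (s k).re) Filter.atTop Filter.atTop)
    (hsol : FormalSeries.subst F (FormalSeries.ofSeq c s hs) = 0)
    (hne : FormalSeries.subst (MvPolynomial.pderiv (some (Fin.last n)) F)
      (FormalSeries.ofSeq c s hs) ≠ 0)
    (hord : ∀ j : Fin (n + 1),
      (FormalSeries.subst (MvPolynomial.pderiv (some (Fin.last n)) F)
        (FormalSeries.ofSeq c s hs)).orderTop ≤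
      (FormalSeries.subst (MvPolynomial.pderiv (some j) F)
        (FormalSeries.ofSeq c s hs)).orderTop)
    (α β : ℝ) (hαβ : α < β) (hopen : β - α < 2 * Real.pi)
    (ℓ : ℂ → ℂ) (hℓ : IsLogBranchOn ℓ (openSector α β)) :
    ∃ r₀ : ℝ, 0 < r₀ ∧ ∀ r : ℝ, 0 < r → r ≤ r₀ →
      ∃ f : ℂ → ℂ, TendstoUniformlyOn
        (fun (N : ℕ) (x : ℂ) => ∑ k ∈ Finset.range N, c k * Complex.exp (s k * ℓ x)) f
        Filter.atTop (openSector α β ∩ Metric.ball 0 r) := by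
  obtain ⟨B, hB⟩ := hℓ.exists_abs_im_le
  obtain ⟨H, hBH, ⟨T₁, hT₁⟩, ⟨T₂, hT₂⟩⟩ := ((Filter.eventually_ge_atTop B).and
    ((FormalSeries.exists_forall_summable F hs hlim hsol hne hord one_ne_zero).and
      (FormalSeries.exists_forall_summable F hs hlim hsol hne hord
        (neg_ne_zero.2 one_ne_zero)))).exists
  set T := min T₁ T₂ with hT
  have hsum := (hT₁ T (min_le_left _ _)).add (hT₂ T (min_le_right _ _))
  refine ⟨Real.exp T, Real.exp_pos T, fun r _ hr => ⟨_, tendstoUniformlyOn_tsum_nat_eventually hsum ?_⟩⟩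
  -- Only finitely many `k` have `Re s_k < 0`; they are left out because their powers grow as `Re ℓ`
  -- decreases.
  filter_upwards [hlim.eventually_ge_atTop 0] with k hk x hx
  have hexp := hℓ.2 x hx.1
  have hre : (ℓ x).re ≤ T := by
    have h1 : ‖x‖ < r := by simpa using hx.2
    rw [← hexp, Complex.norm_exp] at h1
    exact (Real.exp_lt_exp.1 (h1.trans_le hr)).le
  have him : |(s k).im * (ℓ x).im| ≤ H * |(s k).im| := by
    rw [abs_mul, mul_comm]
    exact mul_le_mul_of_nonneg_right ((hB x hx.1).trans hBH) (abs_nonneg _)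
  rw [norm_mul, Complex.norm_exp, Complex.mul_re, ← mul_add]
  refine mul_le_mul_of_nonneg_left ?_ (norm_nonneg _)
  have h1 : (s k).re * (ℓ x).re ≤ T * (s k).re := by
    rw [mul_comm]; exact mul_le_mul_of_nonneg_right hre hk
  have h2 := neg_abs_le ((s k).im * (ℓ x).im)
  -- For `Im s_k ≥ 0` the majorant is the term on the line `h = -H`, otherwise the one on `h = H`.
  rcases abs_choice (s k).im with h3 | h3
  · refine le_add_of_nonneg_of_le (Real.exp_pos _).le (Real.exp_le_exp.2 ?_)
    rw [h3] at him
    linarith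
  · refine le_add_of_le_of_nonneg (Real.exp_le_exp.2 ?_) (Real.exp_pos _).le
    rw [h3] at him
    linarith
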